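/- There are $N$ coins, exactly $k$ of which are false, where $1\le k<N/2$. A weighing places equally many coins on the left and on the right pan and reports only whether the scale is balanced (both pans hold equally many false coins) or tilted. A quantum algorithm alternates arbitrary unitaries, which do not depend on the set of false coins, with calls of the balance oracle $|q,a,z\rangle\mapsto|q,a\oplus\chi(x;q),z\rangle$, where $x$ is the set of false coins, $q$ is a weighing, $\chi(x;q)\in\{0,1\}$ is $1$ iff the scale tilts, $a$ is the answer bit and $z$ is the work register; a weighing (query) is one such call. Fix a constant success probability $p>1/2$. There is a constant $C>0$, depending only on $p$, such that the following holds. (i) Let $0<l_1<l_2$ be real numbers. Every quantum algorithm in which all weighings (including all those in superposition) place either at most $l_1$ or at least $l_2$ coins on each pan, and which identifies every set of $k$ false coins with probability at least $p$, makes at least $$C\cdot\min\left(\left(\frac{N}{l_1k}\right)^{1/2},\ \left(\frac{l_2k}{N}\right)^{1/4}\right)$$ weighings; that is, $\Omega\big(\min((N/(l_1k))^{1/2},(l_2k/N)^{1/4})\big)$ weighings are needed. (ii) In particular, for every $\epsilon\ge 0$, if all weighings place at most $N/k^{1+2\epsilon}$ or at least $N/k^{1-4\epsilon}$ coins on each pan,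 then at least $C\,k^{\epsilon}$ weighings are needed, i.e. $\Omega(k^\epsilon)$. -/

import Mathlib

/-- A placement of `N` coins on the two pans of a balance: `1` means left pan, `-1` means right pan,
`0` means that the coin is not placed. -/
abbrev Placement (N : ℕ) : Type := Fin N → SignType

/-- `q.HasPanSize l`: exactly `l` coins lie on the left pan and exactly `l` on the right pan. -/
def Placement.HasPanSize {N : ℕ} (q : Placement N) (l : ℕ) : Prop :=
  (Finset.univ.filter fun i => q i = 1).card = l ∧
    (Finset.univ.filter fun i => q i = -1).card = l

/-- The answer of the balance when `x` is the set of false coins: `true` if it is tilted,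
`false` if it is balanced. -/
def tilted {N : ℕ} (x : Finset (Fin N)) (q : Placement N) : Bool :=
  decide ((∑ i ∈ x, (q i : ℤ)) ≠ 0)

/-- The weighings with equally many coins on both pans, this number being
at most `l₁` or at least `l₂`. -/
abbrev RestrictedQuery (N : ℕ) (l₁ l₂ : ℝ) : Type :=
  {q : Placement N // ∃ l : ℕ, q.HasPanSize l ∧ ((l : ℝ) ≤ l₁ ∨ l₂ ≤ (l : ℝ))}

noncomputable instance instFintypeRestrictedQuery (N : ℕ) (l₁ l₂ : ℝ) :
    Fintype (RestrictedQuery N l₁ l₂) :=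
  Fintype.ofFinite _

/-- A quantum query algorithm with query strings from `Q` and outputs in `R`. Its state space has the
computational basis `|q, a, z⟩` (query string, answer bit, work register). It starts in a basis state
and alternates the unitaries `U 0, …, U numQueries` (which do not depend on the oracle) with
`numQueries` calls of the oracle; then the basis is measured and the outcome is decoded by `out`. -/
structure QueryAlgorithm (Q : Type) [Fintype Q] [DecidableEq Q] (R : Type) where
  /-- The dimension of the work register. -/
  workDim : ℕ
  /-- The number of oracle calls. -/
  numQueries : ℕ
  /-- The initial basis state. -/
  start : Q × Bool × Fin workDim
  /-- The oracle-independent unitaries; only those with index at most `numQueries` are used. -/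
  U : ℕ → Matrix.unitaryGroup (Q × Bool × Fin workDim) ℂ
  /-- The decoding of the measurement outcome. -/
  out : Q × Bool × Fin workDim → R

namespace QueryAlgorithm

variable {Q : Type} [Fintype Q] [DecidableEq Q] {R : Type}

/-- The oracle unitary `|q, a, z⟩ ↦ |q, a ⊕ ζ q, z⟩` on vectors of amplitudes. (This permutation of
the basis is its own inverse, so the new amplitude at a basis state is the old one at its image.) -/
def applyOracle {Z : Type} (ζ : Q → Bool) (ψ : Q × Bool × Z → ℂ) : Q × Bool × Z → ℂ :=
  fun b => ψ (b.1, xor b.2.1 (ζ b.1), b.2.2)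

/-- The state `U t · O · U (t - 1) ⋯ U 1 · O · U 0 |start⟩`, after `t` calls of the oracle `ζ`. -/
noncomputable def state (A : QueryAlgorithm Q R) (ζ : Q → Bool) :
    ℕ → (Q × Bool × Fin A.workDim → ℂ)
  | 0 => Matrix.mulVec (A.U 0 : Matrix _ _ ℂ) (Pi.single A.start 1)
  | t + 1 => Matrix.mulVec (A.U (t + 1) : Matrix _ _ ℂ) (applyOracle ζ (A.state ζ t))

open Classical in
/-- The probability that the algorithm with oracle `ζ` outputs `r`. -/
noncomputable def outputProb (A : QueryAlgorithm Q R) (ζ : Q → Bool) (r : R) : ℝ :=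
  ∑ b ∈ Finset.univ.filter (fun b => A.out b = r), ‖A.state ζ A.numQueries b‖ ^ 2

end QueryAlgorithm

/-- For every set `x` of exactly `k` false coins among `N`, the algorithm, given the balance oracle of
`x`, outputs `x` with probability at least `p`. -/
def FindsFalseCoins {N : ℕ} {l₁ l₂ : ℝ}
    (A : QueryAlgorithm (RestrictedQuery N l₁ l₂) (Finset (Fin N))) (k : ℕ) (p : ℝ) : Prop :=
  ∀ x : Finset (Fin N), x.card = k → p ≤ A.outputProb (fun q => tilted x q.1) x

/-! A weighing with tiny pans almost surely contains no false coin, so it balances; a weighing with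
huge pans almost surely splits the false coins unevenly, so it tilts. Hence each allowed weighing
has a predictable answer for a uniformly random `k`-set `x` and carries little information.

Quantitatively, let `η` be the oracle that answers "balanced" exactly on small weighings, and let
`δ` bound, for every weighing, the fraction of `x` whose answer differs from `η`. The hybrid
argument (`sqrt_le_of_identifies`) compares the run on `x` with the run on `η`: averaged over `x`,
`T` queries move the state by at most `2T√δ`. The run on `η` does not depend on `x`, so it can guess
`x` only with average probability at most one over the number of sets. Thus `T` is of order at least
`1/√δ`.

It remains to bound `δ`. Small pans of size `l` give `2lk/N` by a union bound (`card_tilted_le`).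
Large pans give `√(2N/(lk))` (`card_balanced_le_sqrt`): given `s` false coins on the pans, an even
split has probability of order `s^(-1/2)` while `s` stays away from the total, and Cauchy–Schwarz
averages this over the hypergeometric `s`. Both bounds are at most `2/m²` for the claimed `m`. -/

namespace QueryAlgorithm

/-! ### Euclidean norm of amplitude vectors -/

section EuclideanNorm

variable {B : Type} [Fintype B]

/-- The Euclidean norm of a vector of amplitudes. -/
noncomputable def amplitudeNorm (ψ : B → ℂ) : ℝ := ‖WithLp.toLp 2 ψ‖

theorem amplitudeNorm_sq (ψ : B → ℂ) : amplitudeNorm ψ ^ 2 = ∑ b, ‖ψ b‖ ^ 2 := by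
  simp [amplitudeNorm, EuclideanSpace.norm_sq_eq]

theorem amplitudeNorm_nonneg (ψ : B → ℂ) : 0 ≤ amplitudeNorm ψ := norm_nonneg _

theorem amplitudeNorm_add_le (ψ φ : B → ℂ) :
    amplitudeNorm (ψ + φ) ≤ amplitudeNorm ψ + amplitudeNorm φ := by
  simpa [amplitudeNorm] using norm_add_le (WithLp.toLp 2 ψ) (WithLp.toLp 2 φ)

theorem amplitudeNorm_sub_le (ψ φ : B → ℂ) :
    amplitudeNorm (ψ - φ) ≤ amplitudeNorm ψ + amplitudeNorm φ := by
  simpa [amplitudeNorm] using norm_sub_le (WithLp.toLp 2 ψ) (WithLp.toLp 2 φ)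

theorem amplitudeNorm_eq_of_sq_eq {B' : Type} [Fintype B'] {ψ : B → ℂ} {φ : B' → ℂ}
    (h : amplitudeNorm ψ ^ 2 = amplitudeNorm φ ^ 2) : amplitudeNorm ψ = amplitudeNorm φ :=
  (sq_eq_sq₀ (amplitudeNorm_nonneg _) (amplitudeNorm_nonneg _)).1 h

theorem amplitudeNorm_comp_equiv (e : B ≃ B) (ψ : B → ℂ) :
    amplitudeNorm (ψ ∘ e) = amplitudeNorm ψ := by
  apply amplitudeNorm_eq_of_sq_eq
  simp only [amplitudeNorm_sq, Function.comp]
  exact e.sum_comp fun b => ‖ψ b‖ ^ 2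

theorem amplitudeNorm_sq_indicator (s : Set B) [DecidablePred (· ∈ s)] (ψ : B → ℂ) :
    amplitudeNorm (s.indicator ψ) ^ 2 = ∑ b with b ∈ s, ‖ψ b‖ ^ 2 := by
  classical
  rw [amplitudeNorm_sq, Finset.sum_filter]
  refine Finset.sum_congr rfl fun b _ => ?_
  by_cases h : b ∈ s <;> simp [h]

theorem amplitudeNorm_indicator_le (s : Set B) (ψ : B → ℂ) :
    amplitudeNorm (s.indicator ψ) ≤ amplitudeNorm ψ := by
  classical
  rw [← sq_le_sq₀ (amplitudeNorm_nonneg _) (amplitudeNorm_nonneg _), amplitudeNorm_sq_indicator,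
    amplitudeNorm_sq]
  exact Finset.sum_le_sum_of_subset_of_nonneg (Finset.filter_subset _ _) fun _ _ _ => by positivity

theorem amplitudeNorm_unitary_mulVec [DecidableEq B] (U : Matrix.unitaryGroup B ℂ) (ψ : B → ℂ) :
    amplitudeNorm (Matrix.mulVec (U : Matrix B B ℂ) ψ) = amplitudeNorm ψ := by
  apply amplitudeNorm_eq_of_sq_eq
  have key (φ : B → ℂ) : ((amplitudeNorm φ ^ 2 : ℝ) : ℂ) = dotProduct (star φ) φ := by
    rw [amplitudeNorm_sq]
    push_cast
    refine Finset.sum_congr rfl fun b _ => ?_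
    simp [← Complex.conj_mul']
  rw [← Complex.ofReal_inj, key, key, Matrix.star_mulVec, Matrix.dotProduct_mulVec,
    Matrix.vecMul_vecMul, ← Matrix.star_eq_conjTranspose, Matrix.UnitaryGroup.star_mul_self,
    Matrix.vecMul_one]

end EuclideanNorm

/-! ### The hybrid argument -/

variable {Q R : Type}

/-- The permutation of the basis performed by an oracle. -/
def oracleEquiv (Z : Type) (ζ : Q → Bool) : Q × Bool × Z ≃ Q × Bool × Z :=
  Function.Involutive.toPerm (fun b => (b.1, xor b.2.1 (ζ b.1), b.2.2)) fun b => by simp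

theorem applyOracle_eq_comp {Z : Type} (ζ : Q → Bool) (ψ : Q × Bool × Z → ℂ) :
    applyOracle ζ ψ = ψ ∘ oracleEquiv Z ζ := rfl

/-- The basis states whose query is answered differently by two oracles. -/
def disagreement (Z : Type) (ζ η : Q → Bool) : Set (Q × Bool × Z) := {b | ζ b.1 ≠ η b.1}

theorem applyOracle_sub_applyOracle {Z : Type} (ζ η : Q → Bool) (φ : Q × Bool × Z → ℂ) :
    applyOracle ζ φ - applyOracle η φ =
      applyOracle ζ ((disagreement Z ζ η).indicator φ) -
        applyOracle η ((disagreement Z ζ η).indicator φ) := by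
  funext b
  by_cases h : ζ b.1 = η b.1 <;> simp [applyOracle, Set.indicator, disagreement, h]

variable [Fintype Q]

theorem amplitudeNorm_applyOracle {Z : Type} [Fintype Z] (ζ : Q → Bool) (ψ : Q × Bool × Z → ℂ) :
    amplitudeNorm (applyOracle ζ ψ) = amplitudeNorm ψ := by
  rw [applyOracle_eq_comp, amplitudeNorm_comp_equiv]

theorem amplitudeNorm_applyOracle_sub_le {Z : Type} [Fintype Z] (ζ η : Q → Bool)
    (φ : Q × Bool × Z → ℂ) :
    amplitudeNorm (applyOracle ζ φ - applyOracle η φ) ≤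
      2 * amplitudeNorm ((disagreement Z ζ η).indicator φ) := by
  rw [applyOracle_sub_applyOracle]
  refine (amplitudeNorm_sub_le _ _).trans_eq ?_
  rw [amplitudeNorm_applyOracle, amplitudeNorm_applyOracle, two_mul]

theorem sum_le_sqrt_card_mul_sum_sq {ι : Type} (X : Finset ι) (f : ι → ℝ) :
    ∑ x ∈ X, f x ≤ √(X.card * ∑ x ∈ X, f x ^ 2) :=
  Real.le_sqrt_of_sq_le sq_sum_le_card_mul_sum_sq

/-- If every query distinguishes the oracle `η` from at most `d` of the oracles
`ζ x`, `x ∈ X`, then the total amplitude on the distinguishing queries is small on average. -/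
theorem sum_amplitudeNorm_sq_disagreement_le {Z : Type} [Fintype Z] {ι : Type} (X : Finset ι)
    (ζ : ι → Q → Bool) (η : Q → Bool) (d : ℝ)
    (hd : ∀ q, ((X.filter fun x => ζ x q ≠ η q).card : ℝ) ≤ d) (φ : Q × Bool × Z → ℂ) :
    ∑ x ∈ X, amplitudeNorm ((disagreement Z (ζ x) η).indicator φ) ^ 2 ≤
      d * amplitudeNorm φ ^ 2 := by
  classical
  simp only [amplitudeNorm_sq]
  rw [Finset.sum_comm, Finset.mul_sum]
  refine Finset.sum_le_sum fun b _ => ?_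
  refine le_trans (le_of_eq ?_) (mul_le_mul_of_nonneg_right (hd b.1) (by positivity))
  rw [← nsmul_eq_mul, ← Finset.sum_const, Finset.sum_filter]
  refine Finset.sum_congr rfl fun x _ => ?_
  by_cases h : ζ x b.1 = η b.1 <;> simp [Set.indicator, disagreement, h]

variable [DecidableEq Q]

theorem amplitudeNorm_state (A : QueryAlgorithm Q R) (ζ : Q → Bool) (t : ℕ) :
    amplitudeNorm (A.state ζ t) = 1 := by
  induction t with
  | zero =>
    rw [state, amplitudeNorm_unitary_mulVec]
    simp [amplitudeNorm]
  | succ t ih => rw [state, amplitudeNorm_unitary_mulVec, amplitudeNorm_applyOracle, ih]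

/-- Unitaries and oracle calls preserve distance, so each query adds only the error of replacing `ζ`
by `η` once. This error is measured on the run with `η`, which stays fixed when `ζ` varies. -/
theorem amplitudeNorm_state_sub_le (A : QueryAlgorithm Q R) (ζ η : Q → Bool) (t : ℕ) :
    amplitudeNorm (A.state ζ t - A.state η t) ≤
      ∑ s ∈ Finset.range t,
        2 * amplitudeNorm ((disagreement (Fin A.workDim) ζ η).indicator (A.state η s)) := by
  induction t with
  | zero => simp [state, amplitudeNorm]
  | succ t ih =>
    rw [state, state, ← Matrix.mulVec_sub, amplitudeNorm_unitary_mulVec, Finset.sum_range_succ]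
    have h : applyOracle ζ (A.state ζ t) - applyOracle η (A.state η t) =
        applyOracle ζ (A.state ζ t - A.state η t) +
          (applyOracle ζ (A.state η t) - applyOracle η (A.state η t)) := by
      funext b
      simp [applyOracle]
    rw [h]
    refine (amplitudeNorm_add_le _ _).trans (add_le_add ?_ (amplitudeNorm_applyOracle_sub_le _ _ _))
    rwa [amplitudeNorm_applyOracle]

theorem outputProb_nonneg (A : QueryAlgorithm Q R) (ζ : Q → Bool) (r : R) :
    0 ≤ A.outputProb ζ r :=
  Finset.sum_nonneg fun _ _ => by positivity

theorem sqrt_outputProb_eq (A : QueryAlgorithm Q R) (ζ : Q → Bool) (r : R) :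
    √(A.outputProb ζ r) =
      amplitudeNorm ({b | A.out b = r}.indicator (A.state ζ A.numQueries)) := by
  classical
  rw [Real.sqrt_eq_iff_eq_sq (A.outputProb_nonneg ζ r) (amplitudeNorm_nonneg _),
    amplitudeNorm_sq_indicator, outputProb]
  exact Finset.sum_congr (by ext; simp) fun _ _ => rfl

theorem sqrt_outputProb_le (A : QueryAlgorithm Q R) (ζ η : Q → Bool) (r : R) :
    √(A.outputProb ζ r) ≤ √(A.outputProb η r) +
      amplitudeNorm (A.state ζ A.numQueries - A.state η A.numQueries) := by
  rw [sqrt_outputProb_eq, sqrt_outputProb_eq]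
  refine le_trans ?_ (add_le_add_right (amplitudeNorm_indicator_le {b | A.out b = r} _) _)
  refine le_trans (le_of_eq ?_) (amplitudeNorm_add_le _ _)
  rw [← Set.indicator_add', add_sub_cancel]

theorem sum_outputProb_le_one (A : QueryAlgorithm Q R) (ζ : Q → Bool) (X : Finset R) :
    ∑ r ∈ X, A.outputProb ζ r ≤ 1 := by
  classical
  have h := amplitudeNorm_sq (A.state ζ A.numQueries)
  rw [amplitudeNorm_state, one_pow] at h
  rw [h]
  simp only [outputProb]
  rw [← Finset.sum_biUnion]
  · exact Finset.sum_le_sum_of_subset_of_nonneg (Finset.subset_univ _) fun _ _ _ => by positivity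
  · intro r _ r' _ hne
    refine Finset.disjoint_left.2 fun b hb hb' => hne ?_
    simp only [Finset.mem_filter] at hb hb'
    rw [← hb.2, ← hb'.2]

/-- The hybrid bound: an algorithm identifying the oracles `ζ x`, `x ∈ X`, makes many queries if
every query is answered by most of them as by the fixed oracle `η`. -/
theorem sqrt_le_of_identifies (A : QueryAlgorithm Q R) (X : Finset R) (hX : X.Nonempty)
    (ζ : R → Q → Bool) (η : Q → Bool) (p δ : ℝ)
    (hδ : ∀ q, ((X.filter fun x => ζ x q ≠ η q).card : ℝ) ≤ δ * X.card)
    (hA : ∀ x ∈ X, p ≤ A.outputProb (ζ x) x) :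
    √p ≤ √(1 / (X.card : ℝ)) + 2 * A.numQueries * √δ := by
  have hM : (0 : ℝ) < X.card := by exact_mod_cast hX.card_pos
  set M : ℝ := (X.card : ℝ) with hMdef
  -- With the single oracle `η`, the outputs `x ∈ X` share total probability at most 1;
  -- Cauchy–Schwarz does the rest.
  have h₁ : ∑ x ∈ X, √(A.outputProb η x) ≤ M * √(1 / M) := by
    refine (sum_le_sqrt_card_mul_sum_sq _ _).trans ?_
    have : M * √(1 / M) = √(M * 1) := by
      nth_rewrite 1 [← Real.sqrt_sq hM.le]
      rw [← Real.sqrt_mul (by positivity)]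
      congr 1
      field_simp
    rw [this]
    refine Real.sqrt_le_sqrt (mul_le_mul_of_nonneg_left ?_ hM.le)
    refine le_trans (le_of_eq ?_) (A.sum_outputProb_le_one η X)
    exact Finset.sum_congr rfl fun x _ => Real.sq_sqrt (A.outputProb_nonneg η x)
  have h₂ (s : ℕ) : ∑ x ∈ X,
      amplitudeNorm ((disagreement (Fin A.workDim) (ζ x) η).indicator (A.state η s)) ≤
        M * √δ := by
    refine (sum_le_sqrt_card_mul_sum_sq _ _).trans ?_
    have h := sum_amplitudeNorm_sq_disagreement_le X ζ η _ hδ (A.state η s)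
    rw [amplitudeNorm_state, one_pow, mul_one] at h
    refine (Real.sqrt_le_sqrt (mul_le_mul_of_nonneg_left h hM.le)).trans_eq ?_
    rw [show M * (δ * M) = M ^ 2 * δ by ring, Real.sqrt_mul (by positivity), Real.sqrt_sq hM.le]
  have h₃ : ∑ x ∈ X, amplitudeNorm (A.state (ζ x) A.numQueries - A.state η A.numQueries) ≤
      2 * A.numQueries * (M * √δ) := by
    refine (Finset.sum_le_sum fun x _ => A.amplitudeNorm_state_sub_le (ζ x) η _).trans ?_
    rw [Finset.sum_comm]
    refine (Finset.sum_le_sum fun s _ => ?_).trans_eq (b := ∑ s ∈ Finset.range A.numQueries,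
      2 * (M * √δ)) ?_
    · rw [← Finset.mul_sum]
      exact mul_le_mul_of_nonneg_left (h₂ s) zero_le_two
    · simp; ring
  have h₄ : M * √p ≤ M * √(1 / M) + 2 * A.numQueries * (M * √δ) := by
    refine le_trans ?_ (add_le_add h₁ h₃)
    rw [← Finset.sum_add_distrib, hMdef, ← nsmul_eq_mul, ← Finset.sum_const]
    exact Finset.sum_le_sum fun x hx =>
      (Real.sqrt_le_sqrt (hA x hx)).trans (A.sqrt_outputProb_le (ζ x) η x)
  refine le_of_mul_le_mul_left ?_ hM
  linarith

end QueryAlgorithm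


/-! ### Estimates for binomial coefficients -/

namespace Nat

theorem two_mul_add_one_mul_centralBinom_sq_le (n : ℕ) :
    (2 * n + 1) * n.centralBinom ^ 2 ≤ 16 ^ n := by
  induction n with
  | zero => simp
  | succ n ih =>
    have h := succ_mul_centralBinom_succ n
    refine Nat.le_of_mul_le_mul_left ?_ (show 0 < (n + 1) ^ 2 by positivity)
    calc (n + 1) ^ 2 * ((2 * (n + 1) + 1) * (n + 1).centralBinom ^ 2)
        = (2 * n + 3) * ((n + 1) * (n + 1).centralBinom) ^ 2 := by ring
      _ = 4 * (2 * n + 3) * (2 * n + 1) * ((2 * n + 1) * n.centralBinom ^ 2) := by rw [h]; ring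
      _ ≤ 4 * (2 * n + 3) * (2 * n + 1) * 16 ^ n := Nat.mul_le_mul_left _ ih
      _ ≤ 16 * (n + 1) ^ 2 * 16 ^ n := Nat.mul_le_mul_right _ (by nlinarith)
      _ = (n + 1) ^ 2 * 16 ^ (n + 1) := by ring

/-- The index starts at 1 because the factor `4 * n` fails at `n = 0`, while the weaker factor `4 *
(n + 1)` does not pass through the induction step. -/
theorem le_four_mul_succ_mul_centralBinom_succ_sq (n : ℕ) :
    16 ^ (n + 1) ≤ 4 * (n + 1) * (n + 1).centralBinom ^ 2 := by
  induction n with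
  | zero => simp [centralBinom]
  | succ n ih =>
    have h := succ_mul_centralBinom_succ (n + 1)
    refine Nat.le_of_mul_le_mul_left ?_ (show 0 < (n + 2) ^ 2 by positivity)
    calc (n + 2) ^ 2 * 16 ^ (n + 2) = 16 * (n + 2) ^ 2 * 16 ^ (n + 1) := by ring
      _ ≤ 16 * (n + 2) ^ 2 * (4 * (n + 1) * (n + 1).centralBinom ^ 2) := Nat.mul_le_mul_left _ ih
      _ = 64 * (n + 2) * ((n + 1) * (n + 2)) * (n + 1).centralBinom ^ 2 := by ring
      _ ≤ 16 * (n + 2) * (2 * (n + 1) + 1) ^ 2 * (n + 1).centralBinom ^ 2 :=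
        Nat.mul_le_mul_right _ (by nlinarith)
      _ = 4 * (n + 2) * ((n + 2) * (n + 2).centralBinom) ^ 2 := by rw [h]; ring
      _ = _ := by ring

theorem le_four_mul_succ_mul_centralBinom_sq (n : ℕ) :
    16 ^ n ≤ 4 * (n + 1) * n.centralBinom ^ 2 := by
  cases n with
  | zero => simp
  | succ n =>
    exact (le_four_mul_succ_mul_centralBinom_succ_sq n).trans
      (Nat.mul_le_mul_right _ (by lia))

open scoped Nat in
theorem add_choose_sq_mul_centralBinom (h j : ℕ) :
    (h + j).choose h ^ 2 * (h + j).centralBinom =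
      h.centralBinom * j.centralBinom * (2 * (h + j)).choose (2 * h) := by
  have e : 2 * (h + j) = 2 * h + 2 * j := by ring
  have c (n : ℕ) : (n.centralBinom : ℚ) = (2 * n)! / (n ! * n !) := by
    rw [centralBinom, two_mul, cast_add_choose]
  have := fun n : ℕ => n.factorial_ne_zero
  rw [← Nat.cast_inj (R := ℚ)]
  push_cast
  rw [c, c, c, e, cast_add_choose, cast_add_choose]
  field_simp

/-- Absorption turns `a.choose s / (s + 1)` into `(a + 1).choose (s + 1) / (a + 1)`; the sum is then
Vandermonde's without its first term, hence the inequality. -/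
theorem sum_choose_mul_choose_div_le (a b k : ℕ) :
    ∑ s ∈ Finset.HasAntidiagonal.antidiagonal k, ((a.choose s.1 * b.choose s.2 : ℕ) : ℝ) * (1 / ((s.1 : ℝ) + 1)) ≤
      ((a + b + 1).choose (k + 1) : ℝ) / (a + 1) := by
  have ha : (0 : ℝ) < a + 1 := by positivity
  rw [le_div_iff₀ ha, Finset.sum_mul, show a + b + 1 = a + 1 + b by ring, add_choose_eq,
    Finset.Nat.antidiagonal_succ, Finset.sum_cons, Finset.sum_map]
  push_cast
  refine le_add_of_nonneg_of_le (by positivity) (Finset.sum_le_sum fun s _ => le_of_eq ?_)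
  have h : ((a : ℝ) + 1) * a.choose s.1 = (a + 1).choose (s.1 + 1) * (s.1 + 1) := by
    exact_mod_cast Nat.add_one_mul_choose_eq a s.1
  have hs : ((s.1 : ℝ) + 1) ≠ 0 := by positivity
  simp only [Function.Embedding.prodMap, Function.Embedding.coeFn_mk, Prod.map,
    Function.Embedding.refl_apply, Nat.succ_eq_add_one]
  field_simp
  linear_combination (b.choose s.2 : ℝ) * h

/-- The companion of `Nat.sum_choose_mul_choose_div_le` for complements. -/
theorem sum_choose_mul_choose_div_sub_le (a b k : ℕ) :
    ∑ s ∈ Finset.HasAntidiagonal.antidiagonal k,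
      ((a.choose s.1 * b.choose s.2 : ℕ) : ℝ) * (1 / (((a - s.1 : ℕ) : ℝ) + 1)) ≤
      ((a + b + 1).choose k : ℝ) / (a + 1) := by
  have ha : (0 : ℝ) < a + 1 := by positivity
  rw [le_div_iff₀ ha, Finset.sum_mul, show a + b + 1 = a + 1 + b by ring, add_choose_eq]
  push_cast
  refine Finset.sum_le_sum fun s _ => ?_
  rcases le_or_gt s.1 a with hs | hs
  · have h : ((a : ℝ) + 1) * a.choose s.1 = (a + 1).choose s.1 * ((a - s.1 : ℕ) + 1) := by
      have := Nat.add_one_mul_choose_eq a (a - s.1)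
      rw [Nat.choose_symm hs, ← Nat.choose_symm (by lia : s.1 ≤ a + 1)] at *
      rw [show a + 1 - s.1 = a - s.1 + 1 by lia]
      exact_mod_cast this
    have hs' : (((a - s.1 : ℕ) : ℝ) + 1) ≠ 0 := by positivity
    refine le_of_eq ?_
    field_simp
    linear_combination (b.choose s.2 : ℝ) * h
  · rw [Nat.choose_eq_zero_of_lt hs]
    simp only [cast_zero, zero_mul]
    positivity

end Nat

/-- A bound on the probability that a uniformly random `s`-subset of `n` coins is split evenly
by a weighing of all of them. -/
noncomputable def evenSplitBound (n s : ℕ) : ℝ :=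
  √(2 * (1 / ((s : ℝ) + 1) + 1 / (((n - s : ℕ) : ℝ) + 1)))

/-- With `l = h + j`, the even-split probability is a quotient of central binomial coefficients, and
`16 ^ n / (4 * (n + 1)) ≤ n.centralBinom ^ 2 ≤ 16 ^ n / (2 * n + 1)` bounds it. -/
theorem choose_sq_le_mul_evenSplitBound {l h : ℕ} (hl : h ≤ l) :
    (l.choose h : ℝ) ^ 2 ≤ (2 * l).choose (2 * h) * evenSplitBound (2 * l) (2 * h) := by
  obtain ⟨j, rfl⟩ := Nat.exists_eq_add_of_le hl
  rw [evenSplitBound, show 2 * (h + j) - 2 * h = 2 * j by lia]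
  set c : ℝ := ((2 * (h + j)).choose (2 * h) : ℝ) with hc
  have e : ((h + j).choose h : ℝ) ^ 2 * (h + j).centralBinom =
      h.centralBinom * j.centralBinom * c := by
    rw [hc]; exact_mod_cast Nat.add_choose_sq_mul_centralBinom h j
  have h₁ : (2 * (h : ℝ) + 1) * h.centralBinom ^ 2 ≤ 16 ^ h := by
    exact_mod_cast Nat.two_mul_add_one_mul_centralBinom_sq_le h
  have h₂ : (2 * (j : ℝ) + 1) * j.centralBinom ^ 2 ≤ 16 ^ j := by
    exact_mod_cast Nat.two_mul_add_one_mul_centralBinom_sq_le j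
  have h₃ : (16 : ℝ) ^ (h + j) ≤ 4 * (h + j + 1) * (h + j).centralBinom ^ 2 := by
    exact_mod_cast Nat.le_four_mul_succ_mul_centralBinom_sq (h + j)
  have hpos : (0 : ℝ) < (h + j).centralBinom := by exact_mod_cast Nat.centralBinom_pos _
  set u : ℝ := ((h + j).centralBinom : ℝ)
  set v : ℝ := (h.centralBinom : ℝ)
  set w : ℝ := (j.centralBinom : ℝ)
  have key : (v * w) ^ 2 ≤
      (2 * (1 / (((2 * h : ℕ) : ℝ) + 1) + 1 / (((2 * j : ℕ) : ℝ) + 1))) * u ^ 2 := by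
    have h₄ : ((2 * (h : ℝ) + 1) * v ^ 2) * ((2 * (j : ℝ) + 1) * w ^ 2) ≤
        4 * (h + j + 1) * u ^ 2 := by
      refine le_trans (mul_le_mul h₁ h₂ (by positivity) (by positivity)) ?_
      rwa [← pow_add]
    have e' : (2 * (1 / (((2 * h : ℕ) : ℝ) + 1) + 1 / (((2 * j : ℕ) : ℝ) + 1))) * u ^ 2 =
        (4 * (h + j + 1) * u ^ 2) / ((2 * (h : ℝ) + 1) * (2 * (j : ℝ) + 1)) := by
      push_cast
      field_simp
      ring
    rw [e', le_div_iff₀ (by positivity)]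
    linarith
  have key' := Real.le_sqrt_of_sq_le key
  rw [Real.sqrt_mul (by positivity), Real.sqrt_sq hpos.le] at key'
  refine le_of_mul_le_mul_right ?_ hpos
  rw [e]
  nlinarith [mul_le_mul_of_nonneg_left key' (show 0 ≤ c by positivity)]

open Finset in
theorem sum_choose_mul_choose_mul_evenSplitBound_le {n b k : ℕ} (hk : 2 * k < n + b) :
    (∑ s ∈ HasAntidiagonal.antidiagonal k, ((n.choose s.1 * b.choose s.2 : ℕ) : ℝ) * evenSplitBound n s.1) ^ 2 ≤
      (n + b).choose k * (4 * (n + b + 1).choose (k + 1) / (n + 1)) := by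
  -- Below the middle, binomial coefficients increase, so the complementary term is absorbed into
  -- the main one.
  have hmono : ((n + b + 1).choose k : ℝ) ≤ (n + b + 1).choose (k + 1) := by
    exact_mod_cast Nat.choose_le_succ_of_lt_half_left (by lia)
  have h₁ := Nat.sum_choose_mul_choose_div_le n b k
  have h₂ := Nat.sum_choose_mul_choose_div_sub_le n b k
  have h₃ : ((n + b + 1).choose k : ℝ) / (n + 1) ≤ (n + b + 1).choose (k + 1) / (n + 1) := by
    gcongr
  have hcs := sum_sq_le_sum_mul_sum_of_sq_le_mul (HasAntidiagonal.antidiagonal k)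
    (r := fun s => ((n.choose s.1 * b.choose s.2 : ℕ) : ℝ) * evenSplitBound n s.1)
    (f := fun s => ((n.choose s.1 * b.choose s.2 : ℕ) : ℝ))
    (g := fun s => ((n.choose s.1 * b.choose s.2 : ℕ) : ℝ) * evenSplitBound n s.1 ^ 2)
    (fun _ _ => by positivity) (fun _ _ => by positivity) (fun _ _ => le_of_eq (by ring))
  refine hcs.trans ?_
  rw [Nat.add_choose_eq]
  push_cast
  refine mul_le_mul_of_nonneg_left ?_ (by positivity)
  have hsq (s : ℕ) : evenSplitBound n s ^ 2 =
      2 * (1 / ((s : ℝ) + 1)) + 2 * (1 / (((n - s : ℕ) : ℝ) + 1)) := by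
    rw [evenSplitBound, Real.sq_sqrt (by positivity), mul_add]
  simp only [hsq, mul_add, sum_add_distrib, mul_left_comm _ (2 : ℝ), ← mul_sum]
  push_cast at h₁ h₂
  have : (4 * (n + b + 1).choose (k + 1) / (n + 1) : ℝ) =
    4 * ((n + b + 1).choose (k + 1) / (n + 1)) := by ring
  rw [this]
  linarith


/-! ### Counting the sets of false coins that tilt or balance a weighing -/

open Finset

namespace Placement

variable {N : ℕ} (q : Placement N)

theorem tilted_eq_false_iff (x : Finset (Fin N)) :
    tilted x q = false ↔ #{i ∈ x | q i = 1} = #{i ∈ x | q i = -1} := by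
  have h : ∑ i ∈ x, (q i : ℤ) = (#{i ∈ x | q i = 1} : ℤ) - #{i ∈ x | q i = -1} := by
    rw [card_filter, card_filter]
    push_cast
    rw [← sum_sub_distrib]
    refine sum_congr rfl fun i _ => ?_
    generalize q i = a
    cases a <;> rfl
  rw [tilted, h, decide_eq_false_iff_not, not_not, sub_eq_zero, Nat.cast_inj]

theorem card_filter_ne_zero (x : Finset (Fin N)) :
    #{i ∈ x | q i ≠ 0} = #{i ∈ x | q i = 1} + #{i ∈ x | q i = -1} := by
  rw [← card_union_of_disjoint]
  · congr 1
    ext i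
    simp only [mem_filter, mem_union, ← and_or_left]
    refine and_congr_right fun _ => ?_
    generalize q i = a
    cases a <;> decide
  · refine disjoint_left.2 fun i hi hi' => ?_
    have h₁ := (mem_filter.1 hi).2
    rw [(mem_filter.1 hi').2] at h₁
    exact absurd h₁ (by decide)

theorem card_filter_ne_zero_add (x : Finset (Fin N)) :
    #{i ∈ x | q i ≠ 0} + #{i ∈ x | q i = 0} = #x := by
  rw [add_comm]
  exact card_filter_add_card_filter_not _

variable {q} {l k : ℕ}

theorem HasPanSize.card_ne_zero (hq : q.HasPanSize l) : #{i | q i ≠ 0} = 2 * l := by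
  rw [card_filter_ne_zero, hq.1, hq.2, two_mul]

theorem HasPanSize.card_eq_zero (hq : q.HasPanSize l) : 2 * l + #{i | q i = 0} = N := by
  rw [← hq.card_ne_zero, card_filter_ne_zero_add, card_univ, Fintype.card_fin]

/-- A set of coins is determined by its traces on the left pan, the right pan and the rest. -/
theorem card_filter_traces_le (hq : q.HasPanSize l) (h r : ℕ) :
    #{x : Finset (Fin N) | #{i ∈ x | q i = 1} = h ∧ #{i ∈ x | q i = -1} = h ∧
      #{i ∈ x | q i = 0} = r} ≤ l.choose h ^ 2 * (#{i | q i = 0}).choose r := by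
  have hcard : #(powersetCard h {i | q i = 1} ×ˢ
      powersetCard h {i | q i = -1} ×ˢ powersetCard r {i | q i = 0}) =
      l.choose h ^ 2 * (#{i | q i = 0}).choose r := by
    rw [card_product, card_product, card_powersetCard, card_powersetCard, card_powersetCard,
      hq.1, hq.2, sq, mul_assoc]
  rw [← hcard]
  refine card_le_card_of_injOn
    (fun x => ({i ∈ x | q i = 1}, {i ∈ x | q i = -1}, {i ∈ x | q i = 0})) ?_ ?_
  · intro x hx
    simp only [coe_filter, mem_univ, true_and, Set.mem_ofPred_eq] at hx
    simp only [coe_product, Set.mem_prod, mem_coe, mem_powersetCard]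
    exact ⟨⟨filter_subset_filter _ (subset_univ _), hx.1⟩,
      ⟨filter_subset_filter _ (subset_univ _), hx.2.1⟩,
      ⟨filter_subset_filter _ (subset_univ _), hx.2.2⟩⟩
  · intro x _ y _ hxy
    simp only [Prod.mk.injEq, Finset.ext_iff, mem_filter] at hxy
    ext i
    have h₁ := hxy.1 i
    have h₂ := hxy.2.1 i
    have h₃ := hxy.2.2 i
    generalize q i = a at h₁ h₂ h₃
    cases a <;> simp_all

/-- Few sets of coins balance a given weighing with large pans. -/
theorem card_balanced_le (hq : q.HasPanSize l) :
    (#{x ∈ powersetCard k univ | tilted x q = false} : ℝ) ≤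
      ∑ s ∈ HasAntidiagonal.antidiagonal k,
        (((2 * l).choose s.1 * (#{i | q i = 0}).choose s.2 : ℕ) : ℝ) *
          evenSplitBound (2 * l) s.1 := by
  rw [card_eq_sum_card_fiberwise (t := HasAntidiagonal.antidiagonal k)
    (f := fun x => (#{i ∈ x | q i ≠ 0}, #{i ∈ x | q i = 0}))]
  · push_cast
    refine sum_le_sum fun s _ => ?_
    -- An odd number of false coins on the pans never balances.
    rcases Nat.even_or_odd' s.1 with ⟨h, hs | hs⟩
    · refine (Nat.cast_le.2 ((card_le_card ?_).trans
        (card_filter_traces_le hq h s.2))).trans ?_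
      · intro x hx
        simp only [mem_filter, mem_univ, true_and, tilted_eq_false_iff, Prod.ext_iff,
          card_filter_ne_zero] at hx ⊢
        lia
      · push_cast
        rw [hs]
        rcases le_or_gt h l with hl | hl
        · have := mul_le_mul_of_nonneg_right (choose_sq_le_mul_evenSplitBound hl)
            (Nat.cast_nonneg (α := ℝ) ((#{i | q i = 0}).choose s.2))
          linarith
        · rw [Nat.choose_eq_zero_of_lt hl]
          simp only [Nat.cast_zero, zero_pow two_ne_zero, zero_mul, evenSplitBound]
          positivity
    · rw [filter_eq_empty_iff.2]
      · simp only [card_empty, Nat.cast_zero, evenSplitBound]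
        positivity
      · intro x hx
        simp only [mem_filter, tilted_eq_false_iff, Prod.ext_iff, card_filter_ne_zero] at hx ⊢
        lia
  · intro x hx
    simp only [coe_filter, mem_powersetCard, Set.mem_ofPred_eq] at hx
    simp only [mem_coe, HasAntidiagonal.mem_antidiagonal, card_filter_ne_zero_add, hx.1.2]

theorem card_balanced_le_sqrt (hq : q.HasPanSize l) (hl : 0 < l) (hk : 1 ≤ k) (hkN : 2 * k < N) :
    (#{x ∈ powersetCard k univ | tilted x q = false} : ℝ) ≤
      √(2 * N / (l * k)) * N.choose k := by
  have hN := hq.card_eq_zero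
  have h := sum_choose_mul_choose_mul_evenSplitBound_le (n := 2 * l) (b := #{i | q i = 0})
    (k := k) (by lia)
  have hb := (pow_le_pow_left₀ (Nat.cast_nonneg _) (card_balanced_le (k := k) hq) 2).trans h
  rw [hN] at hb
  have hc : ((N : ℝ) + 1) * N.choose k = (N + 1).choose (k + 1) * (k + 1) := by
    exact_mod_cast Nat.add_one_mul_choose_eq N k
  have hl' : (0 : ℝ) < l := by exact_mod_cast hl
  have hk' : (0 : ℝ) < k := by exact_mod_cast hk
  have hkN' : (k : ℝ) ≤ N := by exact_mod_cast (by lia : k ≤ N)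
  set M : ℝ := (N.choose k : ℝ)
  have hM : 0 ≤ M := Nat.cast_nonneg _
  -- The exact ratio is `(N + 1) / (k + 1)`, at most `N / k` since `k ≤ N`.
  have hc' : ((N + 1).choose (k + 1) : ℝ) ≤ N / k * M := by
    rw [div_mul_eq_mul_div, le_div_iff₀ hk']
    refine le_of_mul_le_mul_right ?_ (show (0 : ℝ) < k + 1 by positivity)
    nlinarith
  rw [← Real.sqrt_sq hM, ← Real.sqrt_mul (by positivity)]
  refine Real.le_sqrt_of_sq_le (hb.trans ?_)
  push_cast
  calc M * (4 * (N + 1).choose (k + 1) / (2 * l + 1)) ≤ M * (4 * (N / k * M) / (2 * l)) := by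
        gcongr
        linarith
    _ = 2 * N / (l * k) * M ^ 2 := by field_simp; ring

theorem card_filter_mem_powersetCard (i : Fin N) :
    #{x ∈ powersetCard k univ | i ∈ x} ≤ (N - 1).choose (k - 1) := by
  have h : #(powersetCard (k - 1) (univ.erase i)) = (N - 1).choose (k - 1) := by
    rw [card_powersetCard, card_erase_of_mem (mem_univ i), card_univ, Fintype.card_fin]
  rw [← h]
  refine card_le_card_of_injOn (fun x => x.erase i) ?_ ?_
  · intro x hx
    simp only [coe_filter, mem_powersetCard, Set.mem_ofPred_eq] at hx
    simp only [mem_coe, mem_powersetCard, card_erase_of_mem hx.2, hx.1.2, and_true]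
    exact erase_subset_erase _ (subset_univ _)
  · intro x hx y hy hxy
    simp only [coe_filter, Set.mem_ofPred_eq] at hx hy
    rw [← insert_erase hx.2, ← insert_erase hy.2]
    exact congrArg (insert i) hxy

/-- Few sets of coins tilt a given weighing with small pans. -/
theorem card_tilted_le (hq : q.HasPanSize l) (hk : 1 ≤ k) (hkN : 2 * k < N) :
    (#{x ∈ powersetCard k univ | tilted x q = true} : ℝ) ≤ 2 * l * k / N * N.choose k := by
  have h : #{x ∈ powersetCard k univ | tilted x q = true} ≤
      2 * l * (N - 1).choose (k - 1) := by
    rw [← hq.card_ne_zero, ← smul_eq_mul, ← sum_const]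
    refine le_trans (card_le_card ?_) (card_biUnion_le.trans
      (sum_le_sum fun i _ => card_filter_mem_powersetCard i))
    intro x hx
    simp only [mem_biUnion, mem_filter, mem_univ, true_and] at hx ⊢
    by_contra! hno
    have h₀ : ∑ i ∈ x, (q i : ℤ) = 0 := sum_eq_zero fun i hi => by
      by_cases hi₀ : q i = 0
      · simp [hi₀]
      · exact absurd hi (hno i hi₀ hx.1)
    simp [tilted, h₀] at hx
  have hN : (0 : ℝ) < N := by exact_mod_cast (by lia : 0 < N)
  have hc : (N : ℝ) * (N - 1).choose (k - 1) = N.choose k * k := by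
    have := Nat.add_one_mul_choose_eq (N - 1) (k - 1)
    rw [show N - 1 + 1 = N by lia, show k - 1 + 1 = k by lia] at this
    exact_mod_cast this
  have h' : (#{x ∈ powersetCard k univ | tilted x q = true} : ℝ) ≤
      2 * l * (N - 1).choose (k - 1) := by exact_mod_cast h
  refine h'.trans (le_of_eq ?_)
  field_simp
  linear_combination (l : ℝ) * hc

end Placement

/-! ### The query lower bound -/

theorem two_le_choose {N k : ℕ} (hk : 1 ≤ k) (hkN : 2 * k < N) : 2 ≤ N.choose k := by
  obtain ⟨N, rfl⟩ : ∃ n, N = n + 1 := ⟨N - 1, by lia⟩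
  obtain ⟨k, rfl⟩ : ∃ j, k = j + 1 := ⟨k - 1, by lia⟩
  rw [Nat.choose_succ_succ]
  have h₁ := Nat.choose_pos (show k ≤ N by lia)
  have h₂ := Nat.choose_pos (show k + 1 ≤ N by lia)
  lia

/-- A restricted weighing whose answer is nearly constant distinguishes few sets of false coins
from the oracle that answers `balanced` exactly for the small weighings. -/
theorem card_tilted_ne_le {N k : ℕ} {l₁ l₂ m : ℝ} (hk : 1 ≤ k) (hkN : 2 * k < N) (hl : 0 < l₂)
    (hm : 0 < m) (hm₁ : m ^ 2 * (l₁ * k) ≤ N) (hm₂ : m ^ 4 * N ≤ l₂ * k) {l : ℕ}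
    {q : Placement N} (hq : q.HasPanSize l) (hl₁₂ : (l : ℝ) ≤ l₁ ∨ l₂ ≤ l) (b : Bool)
    (hb : b = false ↔ (l : ℝ) ≤ l₁) :
    (#{x ∈ powersetCard k univ | tilted x q ≠ b} : ℝ) ≤ 2 / m ^ 2 * N.choose k := by
  have hN : (0 : ℝ) < N := by exact_mod_cast (by lia : 0 < N)
  have hk' : (0 : ℝ) < k := by exact_mod_cast hk
  cases b
  · have hle := hb.1 rfl
    simp only [ne_eq, Bool.not_eq_false]
    refine (Placement.card_tilted_le hq hk hkN).trans (mul_le_mul_of_nonneg_right ?_ (by positivity))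
    rw [div_le_div_iff₀ hN (by positivity)]
    have : m ^ 2 * (l * k) ≤ m ^ 2 * (l₁ * k) := by gcongr
    linarith
  · have hle : l₂ ≤ l := hl₁₂.resolve_left fun h => by simp at hb; linarith
    have hlpos : (0 : ℝ) < l := hl.trans_le hle
    simp only [ne_eq, Bool.not_eq_true]
    refine (Placement.card_balanced_le_sqrt hq (by exact_mod_cast hlpos) hk hkN).trans
      (mul_le_mul_of_nonneg_right ?_ (by positivity))
    refine Real.sqrt_le_iff.2 ⟨by positivity, ?_⟩
    rw [div_pow, div_le_div_iff₀ (by positivity) (by positivity)]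
    have : l₂ * k ≤ l * k := by gcongr
    nlinarith [mul_pos hlpos hk']

theorem le_numQueries_of_findsFalseCoins {N k : ℕ} {l₁ l₂ p m : ℝ} (hk : 1 ≤ k) (hkN : 2 * k < N)
    (hl : 0 < l₂) (hm : 0 < m) (hm₁ : m ^ 2 * (l₁ * k) ≤ N) (hm₂ : m ^ 4 * N ≤ l₂ * k)
    (A : QueryAlgorithm (RestrictedQuery N l₁ l₂) (Finset (Fin N))) (hA : FindsFalseCoins A k p) :
    (√p - √(1 / 2)) / (2 * √2) * m ≤ A.numQueries := by
  classical
  have hcard : #(powersetCard k (univ : Finset (Fin N))) = N.choose k := by simp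
  have hM := two_le_choose hk hkN
  have h := A.sqrt_le_of_identifies (powersetCard k univ)
    (card_pos.1 (by lia)) (fun x q => tilted x q.1)
    (fun q => decide (¬ ((q.2.choose : ℝ) ≤ l₁))) p (2 / m ^ 2)
    (fun q => by
      rw [hcard]
      exact card_tilted_ne_le hk hkN hl hm hm₁ hm₂ q.2.choose_spec.1 q.2.choose_spec.2 _
        (by rw [decide_eq_false_iff_not, not_not]))
    (fun x hx => hA x (mem_powersetCard.1 hx).2)
  rw [hcard, Real.sqrt_div zero_le_two, Real.sqrt_sq hm.le] at h
  -- At least two candidate sets exist, so guessing succeeds with probability at most `1/2`; this is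
  -- why `p > 1/2` makes the constant positive.
  have h₂ : √(1 / (N.choose k : ℝ)) ≤ √(1 / 2) := by
    refine Real.sqrt_le_sqrt (one_div_le_one_div_of_le two_pos ?_)
    exact_mod_cast hM
  have h₃ : √p - √(1 / 2) ≤ 2 * A.numQueries * (√2 / m) := by linarith
  have hs : 0 < √(2 : ℝ) := by positivity
  rw [div_mul_eq_mul_div, div_le_iff₀ (by positivity)]
  calc (√p - √(1 / 2)) * m ≤ 2 * A.numQueries * (√2 / m) * m := by gcongr
    _ = A.numQueries * (2 * √2) := by field_simp

theorem theorem6 (p : ℝ) (hp : 1 / 2 < p) :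
    ∃ C : ℝ, 0 < C ∧
      (∀ (N k : ℕ) (l₁ l₂ : ℝ), 1 ≤ k → 2 * k < N → 0 < l₁ → l₁ < l₂ →
        ∀ A : QueryAlgorithm (RestrictedQuery N l₁ l₂) (Finset (Fin N)),
          FindsFalseCoins A k p →
          C * min (((N : ℝ) / (l₁ * (k : ℝ))) ^ (1 / 2 : ℝ))
              ((l₂ * (k : ℝ) / (N : ℝ)) ^ (1 / 4 : ℝ)) ≤ (A.numQueries : ℝ)) ∧
      (∀ (ε : ℝ) (N k : ℕ), 0 ≤ ε → 1 ≤ k → 2 * k < N →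
        ∀ A : QueryAlgorithm
            (RestrictedQuery N ((N : ℝ) / (k : ℝ) ^ (1 + 2 * ε)) ((N : ℝ) / (k : ℝ) ^ (1 - 4 * ε)))
            (Finset (Fin N)),
          FindsFalseCoins A k p → C * (k : ℝ) ^ ε ≤ (A.numQueries : ℝ)) := by
  refine ⟨(√p - √(1 / 2)) / (2 * √2), ?_, ?_, ?_⟩
  · have := Real.sqrt_lt_sqrt (by norm_num) hp
    exact div_pos (by linarith) (by positivity)
  · intro N k l₁ l₂ hk hkN hl₁ hl₁₂ A hA
    have hl₂ := hl₁.trans hl₁₂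
    have hN : (0 : ℝ) < N := by exact_mod_cast (by lia : 0 < N)
    have hk' : (0 : ℝ) < k := by exact_mod_cast hk
    have hm : 0 < min (((N : ℝ) / (l₁ * (k : ℝ))) ^ (1 / 2 : ℝ))
        ((l₂ * (k : ℝ) / (N : ℝ)) ^ (1 / 4 : ℝ)) := by positivity
    refine le_numQueries_of_findsFalseCoins hk hkN hl₂ hm ?_ ?_ A hA
    · rw [← le_div_iff₀ (by positivity)]
      refine (pow_le_pow_left₀ hm.le (min_le_left _ _) 2).trans_eq ?_
      rw [← Real.rpow_natCast, ← Real.rpow_mul (by positivity)]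
      norm_num
    · rw [← le_div_iff₀ hN]
      refine (pow_le_pow_left₀ hm.le (min_le_right _ _) 4).trans_eq ?_
      rw [← Real.rpow_natCast, ← Real.rpow_mul (by positivity)]
      norm_num
  -- Here `m = k ^ ε` turns both conditions on `m` into equalities. Part (i) is bypassed because it
  -- needs `l₁ < l₂`, which fails at `ε = 0`.
  · intro ε N k _ hk hkN A hA
    have hN : (0 : ℝ) < N := by exact_mod_cast (by lia : 0 < N)
    have hk' : (0 : ℝ) < k := by exact_mod_cast hk
    refine le_numQueries_of_findsFalseCoins hk hkN (by positivity) (by positivity) ?_ ?_ A hA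
    · refine le_of_eq ?_
      rw [Real.rpow_add hk', Real.rpow_one, mul_comm 2 ε, Real.rpow_mul hk'.le, Real.rpow_two]
      field_simp
    · refine le_of_eq ?_
      rw [Real.rpow_sub hk', Real.rpow_one, mul_comm 4 ε, Real.rpow_mul hk'.le,
        show (4 : ℝ) = (4 : ℕ) by norm_num, Real.rpow_natCast]
      field_simp
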